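/- Let $G$ be a finite group. Then there exist a partially ordered set $P$ with exactly $4|G|$ points and a group isomorphism $\varphi\colon G\to\mathrm{Aut}(P)$, where $\mathrm{Aut}(P)$ is the group of all order automorphisms of $P$ under composition, such that the action $g\cdot x=\varphi(g)(x)$ of $G$ on $P$ is free (that is, $g\cdot x=x$ for some $x\in P$ implies $g=e$) and has exactly $4$ orbits. -/

import Mathlib

universe u

/-! Order four copies of `G` so that left translations are automorphisms. Consecutive levels are
joined only by the identity, so an automorphism preserves levels and acts on all of them by one
permutation `base F` of `G`. After a translation it fixes `1`. If it fixes `g`, it fixes each `g * s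
i` by induction on `i` (`base_mul_generator`): levels 0 and 2 single out the first generator, levels
1 and 3 force the image to be some `g * s k`, and levels 0 and 3 record which indices are adjacent.
As the `s i` generate, it is the identity. -/

/-- A family in a group is irredundant if no member is generated by the others. -/
def Irredundant {G : Type u} [Group G] {n : ℕ} (s : Fin n → G) : Prop :=
  ∀ i, s i ∉ Subgroup.closure (s '' {i}ᶜ)

theorem exists_irredundant_generating_family (G : Type u) [Group G] [Finite G] :
    ∃ (n : ℕ) (s : Fin n → G), Irredundant s ∧ Subgroup.closure (Set.range s) = ⊤ := by
  obtain ⟨S, hS⟩ := Set.Finite.exists_minimal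
    (s := {S : Set G | Subgroup.closure S = ⊤}) (Set.toFinite _) ⟨Set.univ, by simp⟩
  obtain ⟨n, ⟨e⟩⟩ := Finite.exists_equiv_fin S
  let s : Fin n → G := fun i => e.symm i
  have hinj : Function.Injective s := Subtype.val_injective.comp e.symm.injective
  have hrange : Set.range s = S := by
    ext x
    constructor
    · rintro ⟨i, rfl⟩
      exact (e.symm i).2
    · intro hx
      exact ⟨e ⟨x, hx⟩, by simp [s]⟩
  have hgen : Subgroup.closure (Set.range s) = ⊤ := hrange ▸ hS.prop
  refine ⟨n, s, fun i hi => ?_, hgen⟩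
  have hle : Set.range s ⊆ Subgroup.closure (s '' {i}ᶜ) := by
    rintro _ ⟨j, rfl⟩
    by_cases hj : j = i
    · exact hj ▸ hi
    · exact Subgroup.subset_closure ⟨j, hj, rfl⟩
  have htop : Subgroup.closure (s '' {i}ᶜ) = ⊤ :=
    top_le_iff.1 (hgen ▸ (Subgroup.closure_le _).2 hle)
  have hsub : s '' {i}ᶜ ⊆ S := hrange ▸ Set.image_subset_range _ _
  obtain ⟨j, hj, hji⟩ := hS.le_of_le htop hsub (e.symm i).2
  exact hj (hinj hji)

/-- The connection sets of the layered poset of a family `s`: an element `(g, i)` lies below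
`(h, j)`, for `i ≤ j`, when `g⁻¹ * h` belongs to the set indexed by `i` and `j`. -/
def connectionSet {G : Type u} [Group G] {n : ℕ} (s : Fin n → G) : Fin 4 → Fin 4 → Set G
  | 0, 2 => {x | x = 1 ∨ ∃ i : Fin n, i.val = 0 ∧ x = s i}
  | 1, 3 => {x | x = 1 ∨ ∃ i, x = s i}
  | 0, 3 => {x | x = 1 ∨ (∃ i, x = s i) ∨
      ∃ i j : Fin n, j.val = i.val + 1 ∧ x = (s i)⁻¹ * s j}
  | _, _ => {1}

/-- Four copies of `G`, ordered through the connection sets of `s`. -/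
@[ext]
structure LayeredPoset {G : Type u} [Group G] {n : ℕ} (s : Fin n → G) : Type u where
  point : G
  level : Fin 4

namespace LayeredPoset

variable {G : Type u} [Group G] {n : ℕ} {s : Fin n → G}

theorem one_mem_connectionSet (i j : Fin 4) : (1 : G) ∈ connectionSet s i j := by
  fin_cases i <;> fin_cases j <;> simp [connectionSet]

theorem mem_connectionSet_self {i : Fin 4} {x : G} : x ∈ connectionSet s i i ↔ x = 1 := by
  fin_cases i <;> simp [connectionSet]

/-- Only gaps of at least two levels carry nontrivial elements, so one of the factors is `1`; the
sets for (0, 2) and (1, 3) lie in the one for (0, 3). -/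
theorem mul_mem_connectionSet {i j k : Fin 4} (hij : i ≤ j) (hjk : j ≤ k) {x y : G}
    (hx : x ∈ connectionSet s i j) (hy : y ∈ connectionSet s j k) :
    x * y ∈ connectionSet s i k := by
  fin_cases i <;> fin_cases j <;> fin_cases k <;> simp [connectionSet] at * <;> grind

/-- The points of `LayeredPoset s` are pairs of a group element and a level. -/
def equivProd (s : Fin n → G) : LayeredPoset s ≃ G × Fin 4 where
  toFun x := (x.point, x.level)
  invFun p := ⟨p.1, p.2⟩

instance : PartialOrder (LayeredPoset s) where
  le x y := x.level ≤ y.level ∧ x.point⁻¹ * y.point ∈ connectionSet s x.level y.level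
  le_refl x := ⟨le_rfl, by simpa using one_mem_connectionSet _ _⟩
  le_trans x y z hxy hyz := ⟨hxy.1.trans hyz.1, by
    simpa [mul_assoc] using mul_mem_connectionSet hxy.1 hyz.1 hxy.2 hyz.2⟩
  le_antisymm := by
    rintro ⟨g, i⟩ ⟨h, j⟩ hxy hyx
    obtain rfl : i = j := le_antisymm hxy.1 hyx.1
    have h1 : g⁻¹ * h = 1 := mem_connectionSet_self.1 hxy.2
    rw [inv_mul_eq_one.1 h1]

theorem mk_le_mk {g h : G} {i j : Fin 4} :
    (⟨g, i⟩ : LayeredPoset s) ≤ (⟨h, j⟩ : LayeredPoset s) ↔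
      i ≤ j ∧ g⁻¹ * h ∈ connectionSet s i j :=
  Iff.rfl

theorem level_lt_of_lt {x y : LayeredPoset s} (h : x < y) : x.level < y.level := by
  refine lt_of_le_of_ne h.le.1 fun he => h.ne ?_
  have h2 := h.le.2
  rw [he, mem_connectionSet_self, inv_mul_eq_one] at h2
  exact LayeredPoset.ext h2 he

theorem mk_lt_mk (g : G) {i j : Fin 4} (h : i < j) :
    (⟨g, i⟩ : LayeredPoset s) < (⟨g, j⟩ : LayeredPoset s) := by
  refine lt_of_le_of_ne (mk_le_mk.2 ⟨h.le, by simpa using one_mem_connectionSet _ _⟩) fun he => ?_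
  exact h.ne (congrArg level he)

/-- The chain over `g` has four points, and its image must climb strictly through four levels. -/
theorem level_apply (F : LayeredPoset s ≃o LayeredPoset s) (g : G) (i : Fin 4) :
    (F ⟨g, i⟩).level = i := by
  have h01 := level_lt_of_lt (F.lt_iff_lt.2 (mk_lt_mk (s := s) g (show (0 : Fin 4) < 1 by decide)))
  have h12 := level_lt_of_lt (F.lt_iff_lt.2 (mk_lt_mk (s := s) g (show (1 : Fin 4) < 2 by decide)))
  have h23 := level_lt_of_lt (F.lt_iff_lt.2 (mk_lt_mk (s := s) g (show (2 : Fin 4) < 3 by decide)))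
  have h3 := (F ⟨g, 3⟩).level.isLt
  rw [Fin.lt_def] at h01 h12 h23
  fin_cases i <;> apply Fin.ext <;> simp <;> omega

/-- The permutation of `G` that an automorphism induces on the bottom level. -/
def base (F : LayeredPoset s ≃o LayeredPoset s) (g : G) : G := (F ⟨g, 0⟩).point

theorem apply_mk (F : LayeredPoset s ≃o LayeredPoset s) (g : G) (i : Fin 4) :
    F ⟨g, i⟩ = ⟨base F g, i⟩ := by
  have step : ∀ i j : Fin 4, i ≤ j → (∀ x : G, x ∈ connectionSet s i j → x = 1) →
      (F ⟨g, i⟩).point = (F ⟨g, j⟩).point := by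
    intro i j hij hone
    have hle : F ⟨g, i⟩ ≤ F ⟨g, j⟩ := F.le_iff_le.2
      (mk_le_mk.2 ⟨hij, by simpa using one_mem_connectionSet _ _⟩)
    have h := hle.2
    rw [level_apply, level_apply] at h
    exact inv_mul_eq_one.1 (hone _ h)
  have h01 := step 0 1 (by decide) fun _ hx => by simpa [connectionSet] using hx
  have h12 := step 1 2 (by decide) fun _ hx => by simpa [connectionSet] using hx
  have h23 := step 2 3 (by decide) fun _ hx => by simpa [connectionSet] using hx
  refine LayeredPoset.ext ?_ (level_apply F g i)
  fin_cases i
  · rfl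
  · exact h01.symm
  · exact (h01.trans h12).symm
  · exact ((h01.trans h12).trans h23).symm

theorem base_injective (F : LayeredPoset s ≃o LayeredPoset s) : Function.Injective (base F) := by
  intro g h hgh
  have : F ⟨g, 0⟩ = F ⟨h, 0⟩ := by rw [apply_mk, apply_mk, hgh]
  exact congrArg point (F.injective this)

theorem base_mem {F : LayeredPoset s ≃o LayeredPoset s} {g h : G} {i j : Fin 4} (hij : i ≤ j)
    (hx : g⁻¹ * h ∈ connectionSet s i j) : (base F g)⁻¹ * base F h ∈ connectionSet s i j := by
  have h1 : F ⟨g, i⟩ ≤ F ⟨h, j⟩ := F.le_iff_le.2 (mk_le_mk.2 ⟨hij, hx⟩)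
  rw [apply_mk, apply_mk] at h1
  exact h1.2

/-- Any other form of the element would write `s i` or `s k` through the remaining generators. The
second alternative can occur when `(s i)⁻¹ * s k` is an involution. -/
theorem eq_succ_or_eq_pred (hs : Irredundant s) {i k : Fin n} (hki : k ≠ i)
    (h : (s i)⁻¹ * s k ∈ connectionSet s 0 3) : k.val = i.val + 1 ∨ i.val = k.val + 1 := by
  have hmem : ∀ {a b : Fin n}, b ≠ a → s b ∈ Subgroup.closure (s '' {a}ᶜ) := fun hba =>
    Subgroup.subset_closure ⟨_, hba, rfl⟩
  have hne : ∀ a, s a ≠ 1 := fun a ha => hs a (ha ▸ one_mem _)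
  rcases h with h | ⟨m, h⟩ | ⟨m, m', hm, h⟩
  · rw [inv_mul_eq_one] at h
    exact (hs k (h ▸ hmem hki.symm)).elim
  · by_cases hmk : m = k
    · subst hmk
      exact (hne i (inv_eq_one.1 (mul_eq_right.1 h))).elim
    · rw [inv_mul_eq_iff_eq_mul] at h
      exact (hs k (h ▸ mul_mem (hmem hki.symm) (hmem hmk))).elim
  · by_cases hmi : m = i
    · subst hmi
      obtain rfl | hk := eq_or_ne m' k
      · exact Or.inl hm
      · exact (hs k ((mul_left_cancel h) ▸ hmem hk)).elim
    by_cases hmi' : m' = i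
    · subst hmi'
      obtain rfl | hk := eq_or_ne m k
      · exact Or.inr hm
      · rw [inv_mul_eq_iff_eq_mul] at h
        exact (hs k (h ▸ mul_mem (hmem hki.symm)
          (mul_mem (inv_mem (hmem hk)) (hmem hki.symm)))).elim
    · have hi : s i = s k * ((s m)⁻¹ * s m')⁻¹ := by rw [← h]; group
      exact (hs i (hi ▸ mul_mem (hmem hki)
        (inv_mem (mul_mem (inv_mem (hmem hmi)) (hmem hmi'))))).elim

theorem base_mul_generator (hs : Irredundant s) (F : LayeredPoset s ≃o LayeredPoset s) {g : G}
    (hg : base F g = g) (i : Fin n) : base F (g * s i) = g * s i := by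
  have hne : ∀ a, s a ≠ 1 := fun a ha => hs a (ha ▸ one_mem _)
  have hne_base : ∀ i, g⁻¹ * base F (g * s i) ≠ 1 := by
    intro i h
    have h1 := base_injective F (hg.trans (inv_mul_eq_one.1 h))
    exact hne i (left_eq_mul.1 h1)
  have hmem : ∀ {i : Fin n} {a b : Fin 4}, a ≤ b → s i ∈ connectionSet s a b →
      g⁻¹ * base F (g * s i) ∈ connectionSet s a b := by
    intro i a b hab hi
    have h := base_mem (F := F) (g := g) (h := g * s i) hab (by simpa using hi)
    rwa [hg] at h
  obtain ⟨i, hi⟩ := i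
  induction i using Nat.strong_induction_on with
  | _ i ih =>
  rcases i with _ | i
  · rcases hmem (i := ⟨0, hi⟩) (a := 0) (b := 2) (by decide) (Or.inr ⟨_, rfl, rfl⟩) with
      h | ⟨j, hj, h⟩
    · exact (hne_base _ h).elim
    · obtain rfl : j = ⟨0, hi⟩ := Fin.ext hj
      exact inv_mul_eq_iff_eq_mul.1 h
  · have hprev := ih i (Nat.lt_succ_self i) (by omega)
    rcases hmem (i := ⟨i + 1, hi⟩) (a := 1) (b := 3) (by decide) (Or.inr ⟨_, rfl⟩) with h | ⟨k, h⟩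
    · exact (hne_base _ h).elim
    rw [inv_mul_eq_iff_eq_mul] at h
    -- The points `g * s j` with `j ≤ i` are already fixed, so injectivity excludes them as images.
    have hfixed : ∀ j (hj : j < i + 1), k ≠ ⟨j, by omega⟩ := by
      rintro j hj rfl
      have h1 := mul_left_cancel (base_injective F (h.trans (ih j hj (by omega)).symm))
      exact hs ⟨i + 1, hi⟩
        (h1 ▸ Subgroup.subset_closure ⟨⟨j, by omega⟩, by simp; omega, rfl⟩)
    have hedge := base_mem (F := F) (g := g * s ⟨i, by omega⟩) (h := g * s ⟨i + 1, hi⟩)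
      (i := 0) (j := 3) (by decide) (Or.inr (Or.inr ⟨⟨i, by omega⟩, ⟨i + 1, hi⟩, rfl, by group⟩))
    rw [hprev, h, mul_inv_rev, mul_assoc, inv_mul_cancel_left] at hedge
    rcases eq_succ_or_eq_pred hs (hfixed i (by omega)) hedge with hk | hk
    · obtain rfl : k = ⟨i + 1, hi⟩ := Fin.ext hk
      exact h
    · exact (hfixed k.val (by simp at hk; omega) rfl).elim

theorem base_eq_self [Finite G] (hs : Irredundant s)
    (hgen : Subgroup.closure (Set.range s) = ⊤) (F : LayeredPoset s ≃o LayeredPoset s)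
    (h1 : base F 1 = 1) (g : G) : base F g = g := by
  have hg : g ∈ Submonoid.closure (Set.range s) := by
    -- Finiteness makes inverses of generators superfluous.
    rw [← Subgroup.closure_toSubmonoid_of_finite, hgen]
    trivial
  induction hg using Submonoid.closure_induction_right with
  | one => exact h1
  | mul_right x _ y hy hx =>
    obtain ⟨i, rfl⟩ := hy
    exact base_mul_generator hs F hx i

/-- Left translation by `g`. -/
def translate (s : Fin n → G) (g : G) : LayeredPoset s ≃o LayeredPoset s where
  toFun x := ⟨g * x.point, x.level⟩
  invFun x := ⟨g⁻¹ * x.point, x.level⟩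
  left_inv x := LayeredPoset.ext (inv_mul_cancel_left _ _) rfl
  right_inv x := LayeredPoset.ext (mul_inv_cancel_left _ _) rfl
  map_rel_iff' {x y} := by
    change x.level ≤ y.level ∧
      (g * x.point)⁻¹ * (g * y.point) ∈ connectionSet s x.level y.level ↔ x ≤ y
    rw [mul_inv_rev, mul_assoc, inv_mul_cancel_left]
    rfl

/-- Left translation as a homomorphism to the automorphism group. -/
def translateHom (s : Fin n → G) : G →* (LayeredPoset s ≃o LayeredPoset s) where
  toFun := translate s
  map_one' := RelIso.ext fun _ => LayeredPoset.ext (one_mul _) rfl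
  map_mul' _ _ := RelIso.ext fun _ => LayeredPoset.ext (mul_assoc _ _ _) rfl

theorem eq_one_of_translate_apply_eq {g : G} {x : LayeredPoset s} (h : translateHom s g x = x) :
    g = 1 :=
  mul_eq_right.1 (congrArg point h)

theorem translateHom_bijective [Finite G] (hs : Irredundant s)
    (hgen : Subgroup.closure (Set.range s) = ⊤) : Function.Bijective (translateHom s) := by
  constructor
  · rw [injective_iff_map_eq_one]
    intro g hg
    exact eq_one_of_translate_apply_eq (x := (⟨1, 0⟩ : LayeredPoset s)) (by rw [hg]; rfl)
  · intro F
    refine ⟨base F 1, RelIso.ext ?_⟩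
    rintro ⟨g, i⟩
    have h1 : base ((translate s (base F 1)⁻¹) * F) 1 = 1 := inv_mul_cancel _
    have h2 : (base F 1)⁻¹ * base F g = g := base_eq_self hs hgen _ h1 g
    rw [apply_mk F]
    exact LayeredPoset.ext (inv_mul_eq_iff_eq_mul.1 h2).symm rfl

/-- The level is a complete invariant: translations are transitive on each level. -/
theorem card_orbits :
    Nat.card (MulAction.orbitRel.Quotient (LayeredPoset s ≃o LayeredPoset s) (LayeredPoset s)) =
      4 := by
  let level : MulAction.orbitRel.Quotient (LayeredPoset s ≃o LayeredPoset s) (LayeredPoset s) →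
      Fin 4 := Quotient.lift (fun x : LayeredPoset s => x.level) (by
    rintro _ ⟨g, i⟩ ⟨F, rfl⟩
    exact level_apply F g i)
  have hbij : Function.Bijective level := by
    constructor
    · rintro ⟨g, i⟩ ⟨h, j⟩ hij
      obtain rfl : i = j := hij
      exact Quotient.sound ⟨translate s (g * h⁻¹), LayeredPoset.ext (inv_mul_cancel_right g h) rfl⟩
    · intro i
      exact ⟨Quotient.mk _ (⟨1, i⟩ : LayeredPoset s), rfl⟩
  rw [Nat.card_eq_of_bijective level hbij, Nat.card_fin]

end LayeredPoset

/-- Every finite group `G` is isomorphic to the automorphism group `P ≃o P` of a poset `P` with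
`4 * |G|` points, in such a way that the resulting action `g • x = φ g x` of `G` on `P` is free
and has exactly four orbits. -/
theorem theorem1p2 (G : Type u) [Group G] [Finite G] :
    ∃ (P : Type u) (_ : PartialOrder P) (φ : G ≃* (P ≃o P)),
      Nat.card P = 4 * Nat.card G ∧
      (∀ (g : G) (x : P), φ g x = x → g = 1) ∧
      Nat.card (MulAction.orbitRel.Quotient (P ≃o P) P) = 4 := by
  obtain ⟨n, s, hs, hgen⟩ := exists_irredundant_generating_family G
  refine ⟨LayeredPoset s, inferInstance,
    MulEquiv.ofBijective (LayeredPoset.translateHom s) (LayeredPoset.translateHom_bijective hs hgen),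
    ?_, fun g x h => LayeredPoset.eq_one_of_translate_apply_eq h, LayeredPoset.card_orbits⟩
  rw [Nat.card_congr (LayeredPoset.equivProd s), Nat.card_prod, Nat.card_fin, mul_comm]
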